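/- For a finite simple graph $G$, let $\lambda(G)$ denote its spectral radius, i.e. the largest eigenvalue of its adjacency matrix, and let $\delta(G)$ denote its minimum degree. A graph is balanced bipartite if its vertex set is the disjoint union of two sets $X$ and $Y$ with $|X|=|Y|$ such that every edge joins a vertex of $X$ to a vertex of $Y$. For $n\ge 2k+1$, let $B^k_n$ be the graph obtained from the complete bipartite graph $K_{n,n}$ by deleting the edges of a $K_{k,n-k}$, that is, all edges between $k$ vertices of one partite set and $n-k$ vertices of the other. Theorem. Let $k\ge 1$ and $n\ge k^3+2k+4$ be integers, and let $G$ be a balanced bipartite graph of order $2n$ with $\delta(G)\ge k$. If $$\lambda(G)\ge\sqrt{n(n-k)},$$ then $G$ is Hamiltonian (contains a cycle through all of its vertices) unless $G$ is isomorphic to $B^k_n$, in which case $G$ is not Hamiltonian. -/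

import Mathlib

/-- The spectral radius `λ(G)` of a finite graph: the largest eigenvalue of its adjacency matrix
over `ℝ`. -/
noncomputable def SimpleGraph.spectralRad {V : Type*} [Fintype V] [DecidableEq V]
    (G : SimpleGraph V) [DecidableRel G.Adj] : ℝ :=
  sSup {μ : ℝ | Module.End.HasEigenvalue (Matrix.toLin' (G.adjMatrix ℝ)) μ}

/-- `G` is a balanced bipartite graph: its vertices split into two partite sets `X` and `Y` of the
same size such that every edge joins `X` to `Y`. -/
def SimpleGraph.IsBalancedBipartite {V : Type*} [Fintype V] [DecidableEq V]
    (G : SimpleGraph V) : Prop :=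
  ∃ X Y : Finset V, X ∪ Y = Finset.univ ∧ X.card = Y.card ∧
    G.IsBipartiteWith (X : Set V) (Y : Set V)

/-- The graph `B^k_n`: from the complete bipartite graph `K_{n,n}`, delete all edges between the
`k` left vertices with index `< k` and the `n - k` right vertices with index `≥ k`, that is, the
edges of a `K_{k,n-k}`. -/
def graphB (k n : ℕ) : SimpleGraph (Fin n ⊕ Fin n) :=
  (completeBipartiteGraph (Fin n) (Fin n)).deleteEdges
    {e | ∃ i j : Fin n, (i : ℕ) < k ∧ k ≤ (j : ℕ) ∧ e = s(Sum.inl i, Sum.inr j)}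

/-!
Write `λ` for the spectral radius, `X` and `Y` for the two parts, and `e` for the number of edges.

Cauchy–Schwarz applied to an eigenvector gives `λ² ≤ e` in a bipartite graph
(`sq_eigenvalue_le_sum_degree`), so the hypothesis on `λ` yields `e ≥ n (n - k)`.

If `G` is not Hamiltonian, enlarge it to an edge-maximal non-Hamiltonian bipartite graph `H` on the
same parts. Closing up Hamiltonian paths as in Ore's theorem shows that nonadjacent vertices of `H`
in different parts have degree sum at most `n`
(`degree_add_degree_le_of_isHamiltonian_sup_edge`). Together with `e ≥ n (n - k)` and the minimum
degree, this makes some `k` vertices of one part of `H` have only `k` neighbours altogether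
(`exists_sparse_pair`), and `G` inherits this: up to swapping the parts there are `A ⊆ X` and
`B ⊆ Y` of size `k` such that `A` sees only `B`. In other words `G` is a spanning subgraph of
`B^k_n`.

The minimum degree makes `A` complete to `B`. It remains to see that no edge from `X \ A` to `Y` is
missing. The spectral radius of `B^k_n` satisfies `λ² ≈ n (n - k) + k³ / n`, and the loss of such an
edge lowers `λ²` by about `2`, hence below `n (n - k)` once `n` exceeds `k³`; the precise form is
`sq_eigenvalue_lt_of_missing_edge`, which rests on the quadratic form inequality
`quadratic_form_lt`.

Conversely `B^k_n` is not Hamiltonian: a Hamiltonian cycle would have to alternate between `A` and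
`B`, and never leave `A ∪ B` (`not_isHamiltonian_of_neighbors_subset`).
-/

open Finset

/-! ### Hamiltonian cycles as cyclic sequences -/

/-- A Hamiltonian cycle, encoded as an enumeration of the vertices by `ZMod N` in which consecutive
vertices are adjacent; rotating the cycle is then a translation of the index. -/
theorem isHamiltonian_iff_exists_zmod {V : Type*} [Fintype V] [DecidableEq V]
    {G : SimpleGraph V} {N : ℕ} (hN : 3 ≤ N)
    (hV : Fintype.card V = N) :
    G.IsHamiltonian ↔
      ∃ f : ZMod N → V, Function.Injective f ∧ ∀ i, G.Adj (f i) (f (i + 1)) := by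
  obtain ⟨m, rfl⟩ : ∃ m, N = m + 3 := ⟨N - 3, by omega⟩
  have key : G.IsHamiltonian ↔ (SimpleGraph.cycleGraph (m + 3)).IsContained G := by
    rw [SimpleGraph.cycleGraph_isContained_iff (by omega), SimpleGraph.IsHamiltonian]
    simp only [SimpleGraph.Walk.isHamiltonianCycle_iff_isCycle_and_length_eq, hV]
    exact ⟨fun h => h (by omega), fun h _ => h⟩
  rw [key]
  constructor
  · rintro ⟨f⟩
    refine ⟨fun i => f ((ZMod.finEquiv (m + 3)).symm i),
      f.injective.comp (ZMod.finEquiv (m + 3)).symm.injective, fun i => f.toHom.map_adj ?_⟩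
    rw [SimpleGraph.cycleGraph_adj, map_add, map_one]
    exact Or.inr (add_sub_cancel_left _ 1)
  · rintro ⟨f, hf, hadj⟩
    have hsucc : ∀ a b : Fin (m + 3), b - a = 1 →
        G.Adj (f (ZMod.finEquiv (m + 3) a)) (f (ZMod.finEquiv (m + 3) b)) := by
      intro a b h
      rw [sub_eq_iff_eq_add'.1 h, map_add, map_one]
      exact hadj _
    refine ⟨⟨⟨fun i => f (ZMod.finEquiv (m + 3) i), fun {a b} hab => ?_⟩,
      hf.comp (ZMod.finEquiv (m + 3)).injective⟩⟩
    rw [SimpleGraph.cycleGraph_adj] at hab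
    exact hab.elim (fun h => (hsucc b a h).symm) (hsucc a b)

/-- A Hamiltonian path on the indices `0, …, N - 1` whose ends are adjacent is a cyclic sequence. -/
theorem exists_zmod_of_path {V : Type*} {G : SimpleGraph V} {N : ℕ} (hN : 2 ≤ N) (g : ℕ → V)
    (hinj : ∀ i j, i < N → j < N → g i = g j → i = j)
    (hadj : ∀ i, i + 1 < N → G.Adj (g i) (g (i + 1))) (hclose : G.Adj (g (N - 1)) (g 0)) :
    ∃ f : ZMod N → V, Function.Injective f ∧ ∀ i, G.Adj (f i) (f (i + 1)) := by
  have : NeZero N := ⟨by omega⟩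
  refine ⟨fun i => g i.val, fun a b h =>
    ZMod.val_injective N (hinj _ _ a.val_lt b.val_lt h), fun i => ?_⟩
  have hi := i.val_lt
  change G.Adj (g i.val) (g (i + 1).val)
  have h1 : (1 : ZMod N).val = 1 := by
    have : Fact (1 < N) := ⟨by omega⟩
    exact ZMod.val_one N
  by_cases h : i.val + 1 < N
  · rw [ZMod.val_add_of_lt (by omega), h1]
    exact hadj _ h
  · have : (i + 1).val = 0 := by
      rw [ZMod.val_add, h1, show i.val + 1 = N by omega, Nat.mod_self]
    rw [this, show i.val = N - 1 by omega]
    exact hclose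

/-- If the neighbours of a set `A` lie in a set `B` that is no larger than `A`, then in a
Hamiltonian cycle both the successors and the predecessors of `A` fill up `B`. So `A ∪ B` is
closed under successors and is the whole vertex set. -/
theorem not_isHamiltonian_of_neighbors_subset {V : Type*} [Fintype V] [DecidableEq V]
    {G : SimpleGraph V} {N : ℕ} (hN : 3 ≤ N)
    (hV : Fintype.card V = N) {A B : Finset V} (hA : A.Nonempty) (hBA : B.card ≤ A.card)
    (hAB : ∀ a ∈ A, ∀ v, G.Adj a v → v ∈ B) {w : V} (hw : w ∉ A ∪ B) :
    ¬ G.IsHamiltonian := by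
  rw [isHamiltonian_iff_exists_zmod hN hV]
  rintro ⟨f, hf, hadj⟩
  have : NeZero N := ⟨by omega⟩
  have hbij : Function.Bijective f :=
    (Fintype.bijective_iff_injective_and_card f).2 ⟨hf, by simp [hV]⟩
  set I : Finset (ZMod N) := univ.filter fun i => f i ∈ A with hI
  set J : Finset (ZMod N) := univ.filter fun i => f i ∈ B with hJ
  have hcard : ∀ S : Finset V, (univ.filter fun i => f i ∈ S).card = S.card := by
    intro S
    refine Finset.card_bij (fun i _ => f i) (by simp) (fun _ _ _ _ h => hf h) fun v hv => ?_
    obtain ⟨i, rfl⟩ := hbij.2 v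
    exact ⟨i, by simpa using hv, rfl⟩
  have hJI : J.card ≤ I.card := by rw [hJ, hI, hcard, hcard]; exact hBA
  have hpred : I.image (· - 1) = J := by
    refine Finset.eq_of_subset_of_card_le (fun j hj => ?_) ?_
    · obtain ⟨i, hi, rfl⟩ := Finset.mem_image.1 hj
      have := hadj (i - 1)
      rw [sub_add_cancel] at this
      simp only [hJ, mem_filter, mem_univ, true_and]
      exact hAB _ (by simpa [hI] using hi) _ this.symm
    · rwa [Finset.card_image_of_injective _ (sub_left_injective)]
  have hstep : ∀ i, f i ∈ A ∪ B → f (i + 1) ∈ A ∪ B := by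
    intro i hi
    rcases Finset.mem_union.1 hi with h | h
    · exact Finset.mem_union_right _ (hAB _ h _ (hadj i))
    · have hiJ : i ∈ J := by simpa [hJ] using h
      rw [← hpred] at hiJ
      obtain ⟨j, hj, rfl⟩ := Finset.mem_image.1 hiJ
      refine Finset.mem_union_left _ ?_
      rw [sub_add_cancel]
      simpa [hI] using hj
  obtain ⟨a, ha⟩ := hA
  obtain ⟨i, rfl⟩ := hbij.2 a
  obtain ⟨j, rfl⟩ := hbij.2 w
  have hall : ∀ c : ℕ, f (i + c) ∈ A ∪ B := by
    intro c
    induction c with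
    | zero => simpa using Or.inl ha
    | succ c ih => simpa [add_assoc] using hstep _ ih
  apply hw
  have := hall (j - i).val
  rwa [ZMod.natCast_zmod_val, add_sub_cancel] at this

/-- If adding the edge `xy` creates a Hamiltonian cycle, then deleting that edge from the cycle
leaves a Hamiltonian path from `x` to `y`. -/
theorem exists_hamiltonian_path {V : Type*} [Fintype V] [DecidableEq V]
    {H : SimpleGraph V} {N : ℕ} (hN : 3 ≤ N)
    (hV : Fintype.card V = N) (hH : ¬ H.IsHamiltonian) {x y : V}
    (hxy : (H ⊔ SimpleGraph.edge x y).IsHamiltonian) :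
    ∃ g : ℕ → V, (∀ i j, i < N → j < N → g i = g j → i = j) ∧
      (∀ i, i + 1 < N → H.Adj (g i) (g (i + 1))) ∧ g 0 = x ∧ g (N - 1) = y := by
  rw [isHamiltonian_iff_exists_zmod hN hV] at hxy hH
  obtain ⟨f, hf, hadj⟩ := hxy
  push Not at hH
  obtain ⟨c, hc⟩ := hH f hf
  have : NeZero N := ⟨by omega⟩
  have hcases : ∀ i, ¬ H.Adj (f i) (f (i + 1)) →
      (f i = x ∧ f (i + 1) = y) ∨ (f i = y ∧ f (i + 1) = x) := by
    intro i hi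
    have := hadj i
    rw [SimpleGraph.sup_adj, SimpleGraph.edge_adj] at this
    tauto
  have hcast : ∀ i j : ℕ, i < N → j < N → (i : ZMod N) = j → i = j := by
    intro i j hi hj h
    have := congrArg ZMod.val h
    rwa [ZMod.val_natCast_of_lt hi, ZMod.val_natCast_of_lt hj] at this
  have hlast : ((N - 1 : ℕ) : ZMod N) = -1 := by
    rw [Nat.cast_sub (by omega)]; simp
  -- The cycle uses `xy` only at the step out of `c`: for `N ≥ 3`, a second use would repeat a
  -- vertex.
  have hkey : ∀ i, H.Adj (f i) (f (i + 1)) ∨ i = c := by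
    intro i
    by_contra! hi
    rcases hcases i hi.1 with h | h <;> rcases hcases c hc with h' | h'
    · exact hi.2 (hf (h.1.trans h'.1.symm))
    · have h1 := hf (h.1.trans h'.2.symm)
      have h2 := hf (h.2.trans h'.1.symm)
      have h3 : ((2 : ℕ) : ZMod N) = ((0 : ℕ) : ZMod N) := by
        push_cast
        linear_combination h2 - h1
      exact absurd (hcast 2 0 (by omega) (by omega) h3) (by omega)
    · have h1 := hf (h.1.trans h'.2.symm)
      have h2 := hf (h.2.trans h'.1.symm)
      have h3 : ((2 : ℕ) : ZMod N) = ((0 : ℕ) : ZMod N) := by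
        push_cast
        linear_combination h2 - h1
      exact absurd (hcast 2 0 (by omega) (by omega) h3) (by omega)
    · exact hi.2 (hf (h.1.trans h'.1.symm))
  rcases hcases c hc with h | h
  · refine ⟨fun i => f (c - i), fun i j hi hj hij => hcast i j hi hj ?_, fun i hi => ?_, ?_, ?_⟩
    · simpa using hf hij
    · rcases hkey (c - i - 1) with h1 | h1
      · rw [sub_add_cancel] at h1
        simpa [sub_sub] using h1.symm
      · exfalso
        have : ((i + 1 : ℕ) : ZMod N) = ((0 : ℕ) : ZMod N) := by
          push_cast; linear_combination -h1
        exact absurd (hcast _ _ hi (by omega) this) (by omega)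
    · simpa using h.1
    · simp only [hlast]; rw [sub_neg_eq_add]; exact h.2
  · refine ⟨fun i => f (c + 1 + i), fun i j hi hj hij => hcast i j hi hj ?_, fun i hi => ?_, ?_, ?_⟩
    · simpa using hf hij
    · rcases hkey (c + 1 + i) with h1 | h1
      · simpa [add_assoc] using h1
      · exfalso
        have : ((i + 1 : ℕ) : ZMod N) = ((0 : ℕ) : ZMod N) := by
          push_cast; linear_combination h1
        exact absurd (hcast _ _ hi (by omega) this) (by omega)
    · simpa using h.2
    · simp only [hlast]; rw [add_neg_cancel_right]; exact h.1

/-- A Hamiltonian path `g 0, …, g (N-1)` with `g 0 ∼ g (j+1)` and `g j ∼ g (N-1)` closes up to the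
cycle `g j, …, g 0, g (j+1), …, g (N-1)`. -/
theorem isHamiltonian_of_crossing {V : Type*} [Fintype V] [DecidableEq V]
    {H : SimpleGraph V} {N : ℕ} (hN : 3 ≤ N)
    (hV : Fintype.card V = N) {g : ℕ → V} (hinj : ∀ i j, i < N → j < N → g i = g j → i = j)
    (hadj : ∀ i, i + 1 < N → H.Adj (g i) (g (i + 1))) {j : ℕ} (hj : j + 1 < N)
    (h0 : H.Adj (g 0) (g (j + 1))) (hl : H.Adj (g j) (g (N - 1))) : H.IsHamiltonian := by
  rw [isHamiltonian_iff_exists_zmod hN hV]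
  refine exists_zmod_of_path (by omega) (fun i => if i ≤ j then g (j - i) else g i) ?_ ?_ ?_
  · intro a b ha hb hab
    split_ifs at hab <;> have := hinj _ _ (by omega) (by omega) hab <;> omega
  · intro i hi
    rcases lt_trichotomy i j with h | h | h
    · simp only [if_pos h.le, if_pos (show i + 1 ≤ j by omega)]
      have := hadj (j - (i + 1)) (by omega)
      rw [show j - (i + 1) + 1 = j - i by omega] at this
      exact this.symm
    · subst h
      simpa using h0
    · simp only [if_neg (show ¬ i ≤ j by omega), if_neg (show ¬ i + 1 ≤ j by omega)]
      exact hadj i hi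
  · simpa [show ¬ N - 1 ≤ j by omega] using hl.symm

/-! ### Degree sums and edge counting in bipartite graphs -/

/-- Ore-type degree condition: in a bipartite graph without a Hamiltonian cycle, two vertices in
different parts whose edge would create one have degree sum at most `n`. -/
theorem degree_add_degree_le_of_isHamiltonian_sup_edge {V : Type*} [Fintype V] [DecidableEq V]
    {H : SimpleGraph V} [DecidableRel H.Adj]
    {X Y : Finset V} {n : ℕ} (hn : 2 ≤ n) (hV : Fintype.card V = 2 * n) (hX : X.card = n)
    (hb : H.IsBipartiteWith (X : Set V) Y) (hH : ¬ H.IsHamiltonian) {x y : V} (hx : x ∈ X)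
    (hy : y ∈ Y) (hxy : (H ⊔ SimpleGraph.edge x y).IsHamiltonian) :
    H.degree x + H.degree y ≤ n := by
  obtain ⟨g, hinj, hadj, h0, hl⟩ := exists_hamiltonian_path (by omega) hV hH hxy
  have hsurj : ∀ v, ∃ i, i < 2 * n ∧ g i = v := by
    have hbij : Function.Bijective fun i : Fin (2 * n) => g i :=
      (Fintype.bijective_iff_injective_and_card _).2
        ⟨fun a b h => Fin.ext (hinj _ _ a.2 b.2 h), by simp [hV]⟩
    intro v
    obtain ⟨i, hi⟩ := hbij.2 v
    exact ⟨i, i.2, hi⟩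
  -- `A` holds the predecessors, along the path, of the neighbours of `x`.
  set A := ((range (2 * n - 1)).filter fun i => H.Adj x (g (i + 1))).image g with hA
  have hAcard : H.degree x = A.card := by
    rw [hA, Finset.card_image_of_injOn]
    · rw [← SimpleGraph.card_neighborFinset_eq_degree]
      symm
      refine Finset.card_bij (fun i _ => g (i + 1)) (by simp) (fun a ha b hb h => ?_)
        fun v hv => ?_
      · simp only [mem_filter, mem_range] at ha hb
        have := hinj _ _ (by omega) (by omega) h
        omega
      · obtain ⟨i, hi, rfl⟩ := hsurj v
        have hi0 : i ≠ 0 := by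
          rintro rfl
          rw [SimpleGraph.mem_neighborFinset, h0] at hv
          exact hv.ne rfl
        refine ⟨i - 1, ?_, by rw [Nat.sub_add_cancel (by omega)]⟩
        simp only [mem_filter, mem_range]
        rw [Nat.sub_add_cancel (by omega)]
        exact ⟨by omega, by simpa using hv⟩
    · intro a ha b hb h
      simp only [coe_filter, mem_range, Set.mem_ofPred_eq] at ha hb
      exact hinj _ _ (by omega) (by omega) h
  have hAX : A ⊆ X := by
    intro v hv
    simp only [hA, mem_image, mem_filter, mem_range] at hv
    obtain ⟨i, ⟨hi, hadj'⟩, rfl⟩ := hv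
    have hY : g (i + 1) ∈ Y := by
      simpa using hb.mem_of_mem_adj (by simpa using hx) hadj'
    simpa using hb.symm.mem_of_mem_adj (by simpa using hY) (hadj i (by omega)).symm
  have hBX : H.neighborFinset y ⊆ X :=
    SimpleGraph.isBipartiteWith_neighborFinset_subset hb.symm hy
  have hdisj : Disjoint A (H.neighborFinset y) := by
    rw [Finset.disjoint_left]
    intro v hv hvy
    simp only [hA, mem_image, mem_filter, mem_range] at hv
    obtain ⟨i, ⟨hi, hadj'⟩, rfl⟩ := hv
    refine hH (isHamiltonian_of_crossing (by omega) hV hinj hadj (j := i) (by omega) ?_ ?_)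
    · rwa [h0]
    · rw [hl]; simpa [SimpleGraph.adj_comm] using hvy
  rw [hAcard, ← SimpleGraph.card_neighborFinset_eq_degree, ← card_union_of_disjoint hdisj, ← hX]
  exact card_le_card (union_subset hAX hBX)

theorem isHamiltonian_of_complete_between {V : Type*} [Fintype V] [DecidableEq V]
    {H : SimpleGraph V} {X Y : Finset V} {n : ℕ}
    (hn : 2 ≤ n) (hV : Fintype.card V = 2 * n) (hX : X.card = n) (hY : Y.card = n)
    (hd : Disjoint X Y) (h : ∀ x ∈ X, ∀ y ∈ Y, H.Adj x y) : H.IsHamiltonian := by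
  have henum : ∀ S : Finset V, S.card = n → ∃ a : ℕ → V, (∀ i, i < n → a i ∈ S) ∧
      ∀ i j, i < n → j < n → a i = a j → i = j := by
    intro S hS
    let e := S.equivFinOfCardEq hS
    have : NeZero n := ⟨by omega⟩
    refine ⟨fun i => e.symm (Fin.ofNat n i), fun i _ => (e.symm _).2, fun i j hi hj hij => ?_⟩
    have := congrArg Fin.val (e.symm.injective (Subtype.ext hij))
    simpa [Fin.ofNat, Nat.mod_eq_of_lt, hi, hj] using this
  obtain ⟨a, haX, ha⟩ := henum X hX
  obtain ⟨b, hbY, hb⟩ := henum Y hY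
  have hne : ∀ i j, i < n → j < n → a i ≠ b j := fun i j hi hj hij =>
    Finset.disjoint_left.1 hd (haX i hi) (hij ▸ hbY j hj)
  rw [isHamiltonian_iff_exists_zmod (by omega) hV]
  refine exists_zmod_of_path (by omega) (fun i => if i % 2 = 0 then a (i / 2) else b (i / 2))
    ?_ ?_ ?_
  · intro i j hi hj hij
    split_ifs at hij with h1 h2 h2
    · have := ha _ _ (by omega) (by omega) hij; omega
    · exact absurd hij (hne _ _ (by omega) (by omega))
    · exact absurd hij.symm (hne _ _ (by omega) (by omega))
    · have := hb _ _ (by omega) (by omega) hij; omega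
  · intro i hi
    rcases Nat.mod_two_eq_zero_or_one i with h1 | h1
    · simp only [h1, if_true, show (i + 1) % 2 ≠ 0 by omega, if_false]
      exact h _ (haX _ (by omega)) _ (hbY _ (by omega))
    · simp only [h1, show (i + 1) % 2 = 0 by omega, if_true, one_ne_zero, if_false]
      exact (h _ (haX _ (by omega)) _ (hbY _ (by omega))).symm
  · simp only [show (2 * n - 1) % 2 ≠ 0 by omega, if_false, Nat.zero_mod, if_true]
    exact (h _ (haX _ (by omega)) _ (hbY _ (by omega))).symm

theorem sum_add_le_of_le {ι : Type*} [DecidableEq ι] {S : Finset ι} {f : ι → ℕ} {c : ℕ}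
    (hf : ∀ i ∈ S, f i ≤ c) {y : ι} (hy : y ∈ S) : ∑ i ∈ S, f i + c ≤ f y + S.card * c := by
  rw [← Finset.add_sum_erase _ _ hy]
  have h1 := Finset.sum_le_card_nsmul (S.erase y) f c fun i hi => hf i (mem_of_mem_erase hi)
  rw [card_erase_of_mem hy, smul_eq_mul] at h1
  change ∑ i ∈ S.erase y, f i ≤ _ at h1
  have h2 : S.card = (S.card - 1) + 1 := by have := card_pos.2 ⟨y, hy⟩; omega
  have h3 : S.card * c = (S.card - 1) * c + c := by
    conv_lhs => rw [h2]
    ring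
  omega

/-- A dense bipartite graph of minimum degree at least `k` in which nonadjacent vertices of
different parts have degree sum at most `n`. The pair `x₀, y₀` is extremal, and the smaller of its
two degrees is that of `x₀`; counting edges forces it to be `k`, and then the vertices of degree
`k` in `X` are exactly `k` in number and share their `k` neighbours. -/
theorem exists_sparse_pair {V : Type*} [Fintype V] [DecidableEq V]
    {H : SimpleGraph V} [DecidableRel H.Adj] {X Y : Finset V} {k n : ℕ}
    (hk : 1 ≤ k) (hn : k ^ 3 + 2 * k + 4 ≤ n) (hX : X.card = n) (hY : Y.card = n)
    (hb : H.IsBipartiteWith (X : Set V) Y) (hδ : ∀ v, k ≤ H.degree v)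
    (heX : n * n ≤ ∑ x ∈ X, H.degree x + n * k) (heY : n * n ≤ ∑ y ∈ Y, H.degree y + n * k)
    (hore : ∀ x ∈ X, ∀ y ∈ Y, ¬ H.Adj x y → H.degree x + H.degree y ≤ n) {x₀ y₀ : V}
    (hx₀ : x₀ ∈ X) (hy₀ : y₀ ∈ Y) (hna : ¬ H.Adj x₀ y₀)
    (hmax : ∀ x ∈ X, ∀ y ∈ Y, ¬ H.Adj x y →
      H.degree x + H.degree y ≤ H.degree x₀ + H.degree y₀)
    (hle : H.degree x₀ ≤ H.degree y₀) :
    ∃ A B : Finset V, A ⊆ X ∧ B ⊆ Y ∧ A.card = k ∧ B.card = k ∧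
      ∀ a ∈ A, ∀ v, H.Adj a v → v ∈ B := by
  obtain ⟨hkk, hk1⟩ : 2 * k * k + k + 4 ≤ n ∧ (k + 1) * (k + 1) < n := by
    obtain ⟨p, rfl⟩ : ∃ p, k = p + 1 := ⟨k - 1, by omega⟩
    constructor <;> nlinarith [Nat.zero_le (p ^ 3), Nat.zero_le (p ^ 2)]
  have hdY : ∀ y ∈ Y, H.degree y ≤ n := fun y hy =>
    hX ▸ SimpleGraph.isBipartiteWith_degree_le hb.symm hy
  have hdX : ∀ x ∈ X, H.degree x ≤ n := fun x hx =>
    hY ▸ SimpleGraph.isBipartiteWith_degree_le hb hx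
  have hsum := hore _ hx₀ _ hy₀ hna
  have hks := hδ x₀
  obtain ⟨s, hs⟩ : ∃ s, H.degree x₀ = s := ⟨_, rfl⟩
  rw [hs] at hsum hks hmax hle
  -- `Y` splits into the neighbours of `x₀` and the rest, of degree at most `n - s` each.
  set N := H.neighborFinset x₀ with hNdef
  have hNY : N ⊆ Y := SimpleGraph.isBipartiteWith_neighborFinset_subset hb hx₀
  have hNc : N.card = s := (SimpleGraph.card_neighborFinset_eq_degree _ _).trans hs
  have hDc : (Y \ N).card = n - s := by rw [card_sdiff_of_subset hNY, hY, hNc]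
  have hDdeg : ∀ y ∈ Y \ N, H.degree y ≤ n - s := by
    intro y hy
    simp only [hNdef, mem_sdiff, SimpleGraph.mem_neighborFinset] at hy
    have := hore _ hx₀ _ hy.1 hy.2
    omega
  have hsplit : ∑ y ∈ Y, H.degree y = ∑ y ∈ Y \ N, H.degree y + ∑ y ∈ N, H.degree y :=
    (sum_sdiff hNY).symm
  have hD := sum_le_card_nsmul (Y \ N) (fun y => H.degree y) _ hDdeg
  have hN := sum_le_card_nsmul N (fun y => H.degree y) n fun y hy => hdY y (hNY hy)
  rw [hDc, smul_eq_mul] at hD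
  rw [hNc, smul_eq_mul] at hN
  -- The split gives `s (n - s) ≤ n k`, while `s (n - s) ≥ (k + 1) (n - k - 1) > n k` for
  -- `k < s ≤ n / 2`.
  have hsk : s = k := by
    by_contra hne
    have hks' : k + 1 ≤ s := by omega
    obtain ⟨r, hr⟩ : ∃ r, n = s + r := ⟨n - s, by omega⟩
    have hrs : s ≤ r := by omega
    rw [show n - s = r by omega] at hD
    obtain ⟨p, rfl⟩ : ∃ p, s = k + 1 + p := ⟨s - (k + 1), by omega⟩
    obtain ⟨q, rfl⟩ : ∃ q, r = k + 1 + q := ⟨r - (k + 1), by omega⟩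
    subst hr
    linarith [Nat.zero_le (p * q)]
  rw [hsk] at hD hN hDdeg hNc hDc hsum hmax
  -- the vertices of degree `k` in `X`
  set A := X.filter fun x => H.degree x = k with hA
  have hAX : A ⊆ X := filter_subset _ _
  have hAdeg : ∀ a ∈ A, H.degree a = k := fun a ha => (mem_filter.1 ha).2
  have hAge : k ≤ A.card := by
    have h1 : X \ H.neighborFinset y₀ ⊆ A := by
      intro x hx
      simp only [mem_sdiff, SimpleGraph.mem_neighborFinset] at hx
      have := hmax x hx.1 y₀ hy₀ fun h => hx.2 h.symm
      have := hδ x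
      exact mem_filter.2 ⟨hx.1, by omega⟩
    have h2 := card_le_card h1
    rw [card_sdiff_of_subset (SimpleGraph.isBipartiteWith_neighborFinset_subset hb.symm hy₀), hX,
      SimpleGraph.card_neighborFinset_eq_degree] at h2
    omega
  have hXsplit : ∑ x ∈ X, H.degree x = ∑ x ∈ X \ A, H.degree x + ∑ x ∈ A, H.degree x :=
    (sum_sdiff hAX).symm
  have hAsum : ∑ x ∈ A, H.degree x = A.card * k := by
    rw [sum_congr rfl hAdeg, sum_const, smul_eq_mul]
  have hXA : (X \ A).card = n - A.card := by rw [card_sdiff_of_subset hAX, hX]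
  have hAn : A.card ≤ n := hX ▸ card_le_card hAX
  have hAc : A.card = k := by
    by_contra hne
    have h1 := sum_le_card_nsmul (X \ A) (fun x => H.degree x) n fun x hx =>
      hdX x (mem_sdiff.1 hx).1
    rw [hXA, smul_eq_mul] at h1
    obtain ⟨p, hp⟩ : ∃ p, A.card = k + 1 + p := ⟨A.card - (k + 1), by omega⟩
    obtain ⟨r, hr⟩ : ∃ r, n = A.card + r := ⟨n - A.card, by omega⟩
    rw [show n - A.card = r by omega] at h1
    have h2 : n * n ≤ r * n + A.card * k + n * k := by omega
    have h3 : A.card * n ≤ A.card * k + n * k := by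
      have : n * n = A.card * n + r * n := by rw [← add_mul, ← hr]
      omega
    rw [hp] at h3
    have h4 : p * k ≤ p * n := Nat.mul_le_mul_left p (by omega)
    linarith
  rw [hAc] at hAsum hXA
  -- Of the at most `n k` missing edges, `k (n - k)` are at `A`, which leaves `k²` for `X \ A`.
  have hdXA : ∀ x ∈ X \ A, n ≤ H.degree x + k * k := by
    intro x hx
    have h1 := sum_add_le_of_le (f := fun x => H.degree x) (c := n)
      (fun x hx => hdX x (mem_sdiff.1 hx).1) hx
    rw [hXA] at h1
    obtain ⟨r, rfl⟩ : ∃ r, n = k + r := ⟨n - k, by omega⟩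
    rw [show k + r - k = r by omega] at h1
    have : (k + r) * (k + r) = r * (k + r) + (k + r) * k := by ring
    omega
  have hdYl : ∀ y ∈ Y, n ≤ H.degree y + k * k + k := by
    intro y hy
    obtain ⟨r, hr⟩ : ∃ r, n = k + r := ⟨n - k, by omega⟩
    rw [show n - k = r by omega] at hD hDc hDdeg
    by_cases hyN : y ∈ N
    · have h1 := sum_add_le_of_le (f := fun y => H.degree y) (fun y hy => hdY y (hNY hy)) hyN
      rw [hNc] at h1
      subst hr
      linarith
    · have h1 := sum_add_le_of_le (f := fun y => H.degree y) hDdeg (mem_sdiff.2 ⟨hy, hyN⟩)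
      rw [hDc] at h1
      subst hr
      linarith
  -- `X \ A` is complete to `Y`, by the degree sum condition
  have hcomplete : ∀ x ∈ X \ A, ∀ y ∈ Y, H.Adj x y := by
    intro x hx y hy
    by_contra h
    have h1 := hore x (mem_sdiff.1 hx).1 y hy h
    have h2 := hdXA x hx
    have h3 := hdYl y hy
    linarith
  obtain ⟨a₀, ha₀⟩ : A.Nonempty := card_pos.1 (by omega)
  refine ⟨A, H.neighborFinset a₀, hAX,
    SimpleGraph.isBipartiteWith_neighborFinset_subset hb (hAX ha₀), hAc, ?_, ?_⟩
  · rw [SimpleGraph.card_neighborFinset_eq_degree, hAdeg a₀ ha₀]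
  · intro a ha v hv
    by_contra hna'
    rw [SimpleGraph.mem_neighborFinset] at hna'
    have hvY : v ∈ Y := by
      simpa using hb.mem_of_mem_adj (by simpa using hAX ha) hv
    have h1 := hore a₀ (hAX ha₀) v hvY hna'
    rw [hAdeg a₀ ha₀] at h1
    have h2 : insert a (X \ A) ⊆ H.neighborFinset v := by
      intro u hu
      rw [SimpleGraph.mem_neighborFinset]
      rcases mem_insert.1 hu with rfl | hu
      · exact hv.symm
      · exact (hcomplete u hu v hvY).symm
    have h3 := card_le_card h2
    rw [card_insert_of_notMem (fun h => (mem_sdiff.1 h).2 ha), hXA,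
      SimpleGraph.card_neighborFinset_eq_degree] at h3
    omega

/-- The edge-counting stability theorem: a balanced bipartite graph with minimum degree at least
`k` and at least `n (n - k)` edges is Hamiltonian, unless in one of its parts some `k` vertices
have only `k` neighbours between them. -/
theorem exists_sparse_pair_of_not_isHamiltonian {V : Type*} [Fintype V] [DecidableEq V]
    {G : SimpleGraph V} [DecidableRel G.Adj]
    {X Y : Finset V} {k n : ℕ} (hk : 1 ≤ k) (hn : k ^ 3 + 2 * k + 4 ≤ n)
    (hV : Fintype.card V = 2 * n) (hX : X.card = n) (hY : Y.card = n)
    (hb : G.IsBipartiteWith (X : Set V) Y) (hδ : ∀ v, k ≤ G.degree v)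
    (he : n * n ≤ ∑ x ∈ X, G.degree x + n * k) (hG : ¬ G.IsHamiltonian) :
    ∃ A B : Finset V, (A ⊆ X ∧ B ⊆ Y ∨ A ⊆ Y ∧ B ⊆ X) ∧ A.card = k ∧ B.card = k ∧
      ∀ a ∈ A, ∀ v, G.Adj a v → v ∈ B := by
  classical
  -- an edge-maximal non-Hamiltonian bipartite supergraph
  obtain ⟨H, hGH, hHmax⟩ := (Set.toFinite
    {H : SimpleGraph V | H.IsBipartiteWith (X : Set V) Y ∧ ¬ H.IsHamiltonian}).exists_le_maximal
    (a := G) ⟨hb, hG⟩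
  obtain ⟨hbH, hH⟩ := hHmax.prop
  have hd : ∀ v, G.degree v ≤ H.degree v := fun v => SimpleGraph.degree_le_of_le hGH
  have hore : ∀ x ∈ X, ∀ y ∈ Y, ¬ H.Adj x y → H.degree x + H.degree y ≤ n := by
    intro x hx y hy hxy
    refine degree_add_degree_le_of_isHamiltonian_sup_edge (by omega) hV hX hbH hH hx hy ?_
    by_contra hnot
    have hb' : (H ⊔ SimpleGraph.edge x y).IsBipartiteWith (X : Set V) Y := by
      refine ⟨hbH.disjoint, fun v w hvw => ?_⟩
      rw [SimpleGraph.sup_adj, SimpleGraph.edge_adj] at hvw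
      rcases hvw with h | ⟨⟨rfl, rfl⟩ | ⟨rfl, rfl⟩, -⟩
      · exact hbH.mem_of_adj h
      · exact Or.inl ⟨hx, hy⟩
      · exact Or.inr ⟨hy, hx⟩
    have hle := hHmax.le_of_ge (y := H ⊔ SimpleGraph.edge x y) ⟨hb', hnot⟩ le_sup_left
    have hne : x ≠ y := fun h =>
      Set.disjoint_left.1 hb.disjoint (mem_coe.2 hx) (h ▸ mem_coe.2 hy)
    exact hxy (hle (by simp [SimpleGraph.edge_adj, hne]))
  have heX : n * n ≤ ∑ x ∈ X, H.degree x + n * k :=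
    he.trans (Nat.add_le_add_right (sum_le_sum fun v _ => hd v) _)
  have heY : n * n ≤ ∑ y ∈ Y, H.degree y + n * k := by
    rwa [← SimpleGraph.isBipartiteWith_sum_degrees_eq hbH]
  have hδH : ∀ v, k ≤ H.degree v := fun v => (hδ v).trans (hd v)
  -- a nonadjacent pair of largest degree sum
  have hex : ((X ×ˢ Y).filter fun p => ¬ H.Adj p.1 p.2).Nonempty := by
    by_contra hempty
    refine hH (isHamiltonian_of_complete_between (by omega) hV hX hY
      (by simpa using hb.disjoint) fun x hx y hy => ?_)
    by_contra hxy
    exact hempty ⟨(x, y), by simp [hx, hy, hxy]⟩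
  obtain ⟨⟨x₀, y₀⟩, h0, hmax⟩ := exists_max_image _ (fun p => H.degree p.1 + H.degree p.2) hex
  simp only [mem_filter, mem_product] at h0
  have hmax' : ∀ x ∈ X, ∀ y ∈ Y, ¬ H.Adj x y →
      H.degree x + H.degree y ≤ H.degree x₀ + H.degree y₀ := fun x hx y hy hxy =>
    hmax (x, y) (by simp [hx, hy, hxy])
  rcases le_total (H.degree x₀) (H.degree y₀) with hle | hle
  · obtain ⟨A, B, h1, h2, h3, h4, h5⟩ := exists_sparse_pair hk hn hX hY hbH hδH heX heY hore
      h0.1.1 h0.1.2 h0.2 hmax' hle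
    exact ⟨A, B, Or.inl ⟨h1, h2⟩, h3, h4, fun a ha v hv => h5 a ha v (hGH hv)⟩
  · obtain ⟨A, B, h1, h2, h3, h4, h5⟩ := exists_sparse_pair hk hn hY hX hbH.symm hδH heY heX
      (fun y hy x hx hyx => by rw [add_comm]; exact hore x hx y hy fun h => hyx h.symm)
      h0.1.2 h0.1.1 (fun h => h0.2 h.symm)
      (fun y hy x hx hyx => by
        rw [add_comm, add_comm (H.degree y₀)]; exact hmax' x hx y hy fun h => hyx h.symm) hle
    exact ⟨A, B, Or.inr ⟨h1, h2⟩, h3, h4, fun a ha v hv => h5 a ha v (hGH hv)⟩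

/-! ### Eigenvalues of bipartite graphs -/

/-- A positive lower bound for the spectral radius is witnessed by an eigenvector; the positivity
discards the case of an empty spectrum, where the supremum is `0` by convention. -/
theorem exists_eigenvector_of_le_spectralRad {V : Type*} [Fintype V] [DecidableEq V]
    {G : SimpleGraph V} [DecidableRel G.Adj] {c : ℝ}
    (hc : 0 < c) (h : c ≤ G.spectralRad) :
    ∃ μ : ℝ, c ≤ μ ∧ ∃ z : V → ℝ, z ≠ 0 ∧ ∀ v, ∑ w ∈ G.neighborFinset v, z w = μ * z v := by
  set S := {μ : ℝ | Module.End.HasEigenvalue (Matrix.toLin' (G.adjMatrix ℝ)) μ} with hS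
  have hne : S.Nonempty := by
    by_contra hempty
    rw [Set.not_nonempty_iff_eq_empty] at hempty
    rw [SimpleGraph.spectralRad, ← hS, hempty, Real.sSup_empty] at h
    linarith
  have hfin : S.Finite := Module.End.finite_hasEigenvalue _
  have hmem : G.spectralRad ∈ S := hne.csSup_mem hfin
  obtain ⟨z, hz⟩ := Module.End.HasEigenvalue.exists_hasEigenvector hmem
  refine ⟨_, h, z, hz.2, fun v => ?_⟩
  have := congrFun hz.apply_eq_smul v
  simpa [SimpleGraph.adjMatrix_mulVec_apply] using this

/-- For a bipartite graph, the square of a nonzero eigenvalue is the Rayleigh quotient of `N Nᵀ`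
at the restriction of an eigenvector to `X`, where `N` is the biadjacency matrix. -/
theorem sq_mul_sum_sq_eq_of_eigenvector {V : Type*} [Fintype V] [DecidableEq V]
    {G : SimpleGraph V} [DecidableRel G.Adj] {X Y : Finset V}
    (hb : G.IsBipartiteWith (X : Set V) Y) (hXY : X ∪ Y = univ) {μ : ℝ} (hμ : 0 < μ) {z : V → ℝ}
    (hz0 : z ≠ 0) (hz : ∀ v, ∑ w ∈ G.neighborFinset v, z w = μ * z v) :
    μ ^ 2 * ∑ x ∈ X, z x ^ 2 = ∑ y ∈ Y, (∑ u ∈ G.neighborFinset y, z u) ^ 2 ∧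
      0 < ∑ x ∈ X, z x ^ 2 := by
  have hswap : ∑ x ∈ X, ∑ y ∈ G.neighborFinset x, z x * z y =
      ∑ y ∈ Y, ∑ x ∈ G.neighborFinset y, z x * z y := by
    refine Finset.sum_comm' fun x y => ?_
    simp only [SimpleGraph.mem_neighborFinset]
    constructor
    · rintro ⟨hx, hxy⟩
      exact ⟨hxy.symm, by simpa using hb.mem_of_mem_adj (by simpa using hx) hxy⟩
    · rintro ⟨hxy, hy⟩
      exact ⟨by simpa using hb.symm.mem_of_mem_adj (by simpa using hy) hxy, hxy.symm⟩
  have hnorm : ∑ x ∈ X, z x ^ 2 = ∑ y ∈ Y, z y ^ 2 := by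
    have h1 : ∑ x ∈ X, ∑ y ∈ G.neighborFinset x, z x * z y = μ * ∑ x ∈ X, z x ^ 2 := by
      rw [mul_sum]
      refine sum_congr rfl fun x _ => ?_
      rw [← mul_sum, hz]; ring
    have h2 : ∑ y ∈ Y, ∑ x ∈ G.neighborFinset y, z x * z y = μ * ∑ y ∈ Y, z y ^ 2 := by
      rw [mul_sum]
      refine sum_congr rfl fun y _ => ?_
      rw [← sum_mul, hz]; ring
    exact mul_left_cancel₀ hμ.ne' (by rw [← h1, ← h2, hswap])
  refine ⟨?_, ?_⟩
  · rw [hnorm, mul_sum]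
    exact sum_congr rfl fun y _ => by rw [hz]; ring
  · refine lt_of_le_of_ne (sum_nonneg fun _ _ => sq_nonneg _) fun h0 => hz0 ?_
    have hX := (sum_eq_zero_iff_of_nonneg fun i _ => sq_nonneg (z i)).1 h0.symm
    have hY := (sum_eq_zero_iff_of_nonneg fun i _ => sq_nonneg (z i)).1 (hnorm ▸ h0).symm
    funext v
    have hv : v ∈ X ∪ Y := hXY ▸ mem_univ v
    rcases mem_union.1 hv with h | h
    · simpa using hX v h
    · simpa using hY v h

/-- `λ² ≤ e(G)` for bipartite graphs, by Cauchy–Schwarz at each vertex of `Y`. -/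
theorem sq_eigenvalue_le_sum_degree {V : Type*} [Fintype V] [DecidableEq V]
    {G : SimpleGraph V} [DecidableRel G.Adj] {X Y : Finset V}
    (hb : G.IsBipartiteWith (X : Set V) Y) (hXY : X ∪ Y = univ) {μ : ℝ} (hμ : 0 < μ) {z : V → ℝ}
    (hz0 : z ≠ 0) (hz : ∀ v, ∑ w ∈ G.neighborFinset v, z w = μ * z v) :
    μ ^ 2 ≤ ((∑ x ∈ X, G.degree x : ℕ) : ℝ) := by
  obtain ⟨h1, h2⟩ := sq_mul_sum_sq_eq_of_eigenvector hb hXY hμ hz0 hz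
  refine le_of_mul_le_mul_right ?_ h2
  rw [h1, SimpleGraph.isBipartiteWith_sum_degrees_eq hb, Nat.cast_sum, sum_mul]
  refine sum_le_sum fun y hy => ?_
  refine sq_sum_le_card_mul_sum_sq.trans ?_
  rw [SimpleGraph.card_neighborFinset_eq_degree]
  refine mul_le_mul_of_nonneg_left ?_ (Nat.cast_nonneg _)
  exact sum_le_sum_of_subset_of_nonneg
    (SimpleGraph.isBipartiteWith_neighborFinset_subset hb.symm hy) fun _ _ _ => sq_nonneg _

/-- The quadratic form inequality behind the spectral gap. With `S = X \ A` and `x₀ ∈ S`, the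
numbers stand for `T = ∑_A |z|`, `σ = ∑_S |z|`, `t = |z x₀|`, and for the sums of squares `a` over
`A` and `b` over `S \ {x₀}`; the term `t (2σ - t)` is the loss from the missing edge at `x₀`. -/
theorem quadratic_form_lt {k m σ T t a b : ℝ} (hk : 1 ≤ k) (hm : k ^ 3 + k + 4 ≤ m)
    (ht : 0 ≤ t) (htσ : t ≤ σ) (ha : T ^ 2 ≤ k * a) (hb : (σ - t) ^ 2 ≤ (m - 1) * b)
    (hpos : 0 < a + b + t ^ 2) :
    k * (σ + T) ^ 2 + m * σ ^ 2 - t * (2 * σ - t) < (m + k) * m * (a + b + t ^ 2) := by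
  have hk3 : 0 < k ^ 3 := by positivity
  have hm1 : 0 < m - 1 := by linarith
  have hm0 : 0 < m := by linarith
  have hk0 : 0 < k := by linarith
  -- The part of the form on `S`, with `σ ^ 2 / m` to spare. Multiplied by `m - 1`, the difference of
  -- the two sides is at least `(m n - m + 1) (σ - m t)² + m (m - 1)² t²`, where `n = m + k`.
  have hS : (m * (m + k) + 1) * σ ^ 2 ≤
      m * ((m + k) * m * (b + t ^ 2) + t * (2 * σ - t)) := by
    have h1 : m * ((m + k) * m) * (σ - t) ^ 2 ≤ m * ((m + k) * m) * ((m - 1) * b) :=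
      mul_le_mul_of_nonneg_left hb (by positivity)
    have h2 : 0 ≤ (m * (m + k) - m + 1) * (σ - m * t) ^ 2 + m * (m - 1) ^ 2 * t ^ 2 := by
      have : 0 ≤ m * (m + k) - m + 1 := by nlinarith
      positivity
    refine le_of_mul_le_mul_left ?_ hm1
    linarith
  by_cases h0 : T = 0 ∧ σ = 0
  · obtain ⟨rfl, rfl⟩ := h0
    obtain rfl : t = 0 := le_antisymm htσ ht
    have : 0 < (m + k) * m * (a + b + 0 ^ 2) := by positivity
    simpa using this
  -- the part on `A` and the cross terms, absorbed by `σ ^ 2 / m`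
  have hA : 0 < m * ((m + k) * m - k ^ 2) * T ^ 2 - 2 * k ^ 2 * m * σ * T + k * σ ^ 2 := by
    have hcoef : 0 < k * m * (m * (m + k - k ^ 3) - k ^ 2) := by
      have h1 : 2 * k + 4 ≤ m + k - k ^ 3 := by linarith
      have h2 : m * (2 * k + 4) ≤ m * (m + k - k ^ 3) := mul_le_mul_of_nonneg_left h1 hm0.le
      have h3 : k ≤ m := by linarith
      have : 0 < m * (m + k - k ^ 3) - k ^ 2 := by nlinarith
      positivity
    have h1 : 0 < (k * σ - k ^ 2 * m * T) ^ 2 + k * m * (m * (m + k - k ^ 3) - k ^ 2) * T ^ 2 := by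
      by_cases hT : T = 0
      · have hσ : σ ≠ 0 := fun h => h0 ⟨hT, h⟩
        rw [hT]
        have : 0 < (k * σ) ^ 2 := by positivity
        simpa using this
      · have : 0 < T ^ 2 := by positivity
        have h2 := mul_pos hcoef this
        have h3 := sq_nonneg (k * σ - k ^ 2 * m * T)
        linarith
    refine (mul_pos_iff_of_pos_left hk0).1 ?_
    linarith
  have hA' : m * ((m + k) * m) * T ^ 2 ≤ m * ((m + k) * m) * (k * a) :=
    mul_le_mul_of_nonneg_left ha (by positivity)
  refine lt_of_mul_lt_mul_left ?_ (show 0 ≤ k * m by positivity)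
  have hS' := mul_le_mul_of_nonneg_left hS hk0.le
  linarith

/-- Spectral gap: if the `k` vertices of `A` see only the `k` vertices of `B` and moreover some
edge between `X \ A` and `Y` is missing, then every eigenvalue `μ` has `μ² < n (n - k)`. -/
theorem sq_eigenvalue_lt_of_missing_edge {V : Type*} [Fintype V] [DecidableEq V]
    {G : SimpleGraph V} [DecidableRel G.Adj]
    {X Y A B : Finset V} {k n : ℕ} (hk : 1 ≤ k) (hn : k ^ 3 + 2 * k + 4 ≤ n)
    (hX : X.card = n) (hY : Y.card = n) (hb : G.IsBipartiteWith (X : Set V) Y)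
    (hXY : X ∪ Y = univ) (hAX : A ⊆ X) (hBY : B ⊆ Y) (hA : A.card = k) (hB : B.card = k)
    (hAB : ∀ a ∈ A, ∀ v, G.Adj a v → v ∈ B) {x₀ y₀ : V} (hx₀ : x₀ ∈ X \ A) (hy₀ : y₀ ∈ Y)
    (hna : ¬ G.Adj x₀ y₀) {μ : ℝ} (hμ : 0 < μ) {z : V → ℝ} (hz0 : z ≠ 0)
    (hz : ∀ v, ∑ w ∈ G.neighborFinset v, z w = μ * z v) :
    μ ^ 2 < n * ((n : ℝ) - k) := by
  obtain ⟨h1, h2⟩ := sq_mul_sum_sq_eq_of_eigenvector hb hXY hμ hz0 hz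
  set S := X \ A with hS
  set σ := ∑ u ∈ S, |z u| with hσ
  set T := ∑ u ∈ A, |z u| with hT
  set t := |z x₀| with ht
  have ht0 : 0 ≤ t := abs_nonneg _
  have hT0 : 0 ≤ T := sum_nonneg fun _ _ => abs_nonneg _
  have hσt : σ = t + ∑ u ∈ S.erase x₀, |z u| := (add_sum_erase S (fun u => |z u|) hx₀).symm
  have htσ : t ≤ σ := by
    have : 0 ≤ ∑ u ∈ S.erase x₀, |z u| := sum_nonneg fun _ _ => abs_nonneg _
    linarith
  have hσ0 : 0 ≤ σ := ht0.trans htσ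
  -- the neighbourhood sum at `y`, were `y` adjacent to all it may be adjacent to
  let base : V → ℝ := fun y => σ + if y ∈ B then T else 0
  let R : V → Finset V := fun y => if y ∈ B then X else S
  have hR : ∀ y ∈ Y, G.neighborFinset y ⊆ R y := by
    intro y hy u hu
    have huX := SimpleGraph.isBipartiteWith_neighborFinset_subset hb.symm hy hu
    by_cases hyB : y ∈ B
    · simpa [R, hyB] using huX
    · simp only [R, hyB, if_false, hS, mem_sdiff]
      exact ⟨huX, fun huA => hyB (hAB u huA y (by simpa [SimpleGraph.adj_comm] using hu))⟩
  have hRsum : ∀ y, ∑ u ∈ R y, |z u| = base y := by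
    intro y
    by_cases hyB : y ∈ B
    · simp only [R, base, hyB, if_true]
      exact (sum_sdiff hAX).symm
    · simp [R, base, hyB, hσ]
  have hbase : ∀ y, σ ≤ base y := by
    intro y
    by_cases hyB : y ∈ B <;> simp [base, hyB, hT0]
  have hle : ∀ y ∈ Y, (∑ u ∈ G.neighborFinset y, z u) ^ 2 ≤ base y ^ 2 := by
    intro y hy
    refine sq_le_sq' ?_ ?_
    all_goals
      have := (abs_sum_le_sum_abs z (G.neighborFinset y)).trans
        ((sum_le_sum_of_subset_of_nonneg (hR y hy) fun _ _ _ => abs_nonneg _).trans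
          (hRsum y).le)
      have := abs_le.1 this
      linarith
  have hle₀ : (∑ u ∈ G.neighborFinset y₀, z u) ^ 2 ≤ base y₀ ^ 2 - t * (2 * σ - t) := by
    have hx₀R : x₀ ∈ R y₀ := by
      by_cases hyB : y₀ ∈ B
      · simpa [R, hyB] using (mem_sdiff.1 hx₀).1
      · simpa [R, hyB] using hx₀
    have hsub : G.neighborFinset y₀ ⊆ (R y₀).erase x₀ := by
      intro u hu
      refine mem_erase.2 ⟨?_, hR y₀ hy₀ hu⟩
      rintro rfl
      exact hna (by simpa [SimpleGraph.adj_comm] using hu)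
    have h3 : ∑ u ∈ (R y₀).erase x₀, |z u| = base y₀ - t := by
      rw [← hRsum, ← add_sum_erase (R y₀) (fun u => |z u|) hx₀R]
      ring
    have h4 := (abs_sum_le_sum_abs z (G.neighborFinset y₀)).trans
      ((sum_le_sum_of_subset_of_nonneg hsub fun _ _ _ => abs_nonneg _).trans h3.le)
    have h5 : (∑ u ∈ G.neighborFinset y₀, z u) ^ 2 ≤ (base y₀ - t) ^ 2 :=
      sq_le_sq' (by linarith [abs_le.1 h4]) (abs_le.1 h4).2
    nlinarith [mul_le_mul_of_nonneg_left (hbase y₀) ht0]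
  have hkn : k ≤ n := by nlinarith [Nat.zero_le (k ^ 3)]
  have hbsum : ∑ y ∈ Y, base y ^ 2 = k * (σ + T) ^ 2 + ((n : ℝ) - k) * σ ^ 2 := by
    rw [← sum_sdiff hBY, add_comm]
    congr 1
    · rw [sum_congr rfl (g := fun _ => (σ + T) ^ 2) fun y hy => by simp [base, hy], sum_const, hB,
        nsmul_eq_mul]
    · rw [sum_congr rfl (g := fun _ => σ ^ 2) fun y hy => by simp [base, (mem_sdiff.1 hy).2],
        sum_const, card_sdiff_of_subset hBY, hB, hY, nsmul_eq_mul, Nat.cast_sub hkn]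
  have hupper : ∑ y ∈ Y, (∑ u ∈ G.neighborFinset y, z u) ^ 2 ≤
      k * (σ + T) ^ 2 + ((n : ℝ) - k) * σ ^ 2 - t * (2 * σ - t) := by
    rw [← hbsum, ← add_sum_erase _ _ hy₀, ← add_sum_erase _ _ hy₀]
    have := sum_le_sum fun y (hy : y ∈ Y.erase y₀) => hle y (mem_of_mem_erase hy)
    linarith
  have hXsum : ∑ x ∈ X, z x ^ 2 =
      ∑ x ∈ A, z x ^ 2 + ∑ x ∈ S.erase x₀, z x ^ 2 + t ^ 2 := by
    rw [← sum_sdiff hAX, ← hS, ← add_sum_erase S _ hx₀, ht, sq_abs]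
    ring
  have hSc : ((S.erase x₀).card : ℝ) = (n : ℝ) - k - 1 := by
    have h6 : 1 ≤ S.card := card_pos.2 ⟨_, hx₀⟩
    have h7 : S.card = n - k := by rw [hS, card_sdiff_of_subset hAX, hA, hX]
    rw [card_erase_of_mem hx₀, Nat.cast_sub h6, h7, Nat.cast_sub hkn, Nat.cast_one]
  have hcs : ∀ U : Finset V, (∑ u ∈ U, |z u|) ^ 2 ≤ U.card * ∑ u ∈ U, z u ^ 2 := by
    intro U
    simpa using sq_sum_le_card_mul_sum_sq (s := U) (f := fun u => |z u|)
  have hq := quadratic_form_lt (k := k) (m := (n : ℝ) - k) (σ := σ) (T := T) (t := t)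
    (a := ∑ x ∈ A, z x ^ 2) (b := ∑ x ∈ S.erase x₀, z x ^ 2) (by exact_mod_cast hk)
    (by
      have : (k : ℝ) ^ 3 + 2 * k + 4 ≤ n := by exact_mod_cast hn
      linarith)
    ht0 htσ (by simpa [hA] using hcs A)
    (by
      have := hcs (S.erase x₀)
      rwa [hSc, show ∑ u ∈ S.erase x₀, |z u| = σ - t by linarith] at this)
    (hXsum ▸ h2)
  rw [← hXsum, sub_add_cancel] at hq
  exact lt_of_mul_lt_mul_right ((h1.trans_le hupper).trans_lt hq) h2.le

/-! ### The extremal graph -/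

theorem graphB_adj_inl_inr {k n : ℕ} (i j : Fin n) :
    (graphB k n).Adj (Sum.inl i) (Sum.inr j) ↔ ((i : ℕ) < k → (j : ℕ) < k) := by
  simp only [graphB, SimpleGraph.deleteEdges_adj, completeBipartiteGraph_adj, Set.mem_ofPred_eq]
  constructor
  · rintro ⟨-, h⟩ hi
    by_contra hj
    exact h ⟨i, j, hi, by omega, rfl⟩
  · intro h
    refine ⟨by simp, ?_⟩
    rintro ⟨i', j', hi, hj, he⟩
    obtain ⟨rfl, rfl⟩ : i = i' ∧ j = j' := by simpa using he
    have := h hi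
    omega

theorem graphB_not_adj_inl_inl {k n : ℕ} (i j : Fin n) :
    ¬ (graphB k n).Adj (Sum.inl i) (Sum.inl j) := by
  simp [graphB]

theorem graphB_not_adj_inr_inr {k n : ℕ} (i j : Fin n) :
    ¬ (graphB k n).Adj (Sum.inr i) (Sum.inr j) := by
  simp [graphB]

theorem exists_equiv_fin_lt_iff {V : Type*} [DecidableEq V] {S A : Finset V} {k n : ℕ}
    (hAS : A ⊆ S) (hS : S.card = n) (hA : A.card = k) :
    ∃ e : S ≃ Fin n, ∀ x, (e x : ℕ) < k ↔ (x : V) ∈ A := by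
  have hkn : k ≤ n := hA ▸ hS ▸ card_le_card hAS
  have h1 : Fintype.card {x : S // (x : V) ∈ A} = Fintype.card {i : Fin n // (i : ℕ) < k} := by
    rw [Fintype.card_subtype, Fintype.card_subtype, Fin.card_filter_val_lt, min_eq_right hkn, ← hA]
    exact card_bij (fun x _ => x.1) (by simp) (fun _ _ _ _ h => Subtype.ext h)
      fun a ha => ⟨⟨a, hAS ha⟩, by simpa using ha, rfl⟩
  have h2 : Fintype.card {x : S // ¬ (x : V) ∈ A} = Fintype.card {i : Fin n // ¬ (i : ℕ) < k} := by
    rw [Fintype.card_subtype_compl, Fintype.card_subtype_compl, h1, Fintype.card_coe, hS,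
      Fintype.card_fin]
  let e₁ := Fintype.equivOfCardEq h1
  let e₂ := Fintype.equivOfCardEq h2
  refine ⟨(Equiv.sumCompl fun x : S => (x : V) ∈ A).symm.trans
    ((e₁.sumCongr e₂).trans (Equiv.sumCompl _)), fun x => ?_⟩
  by_cases hx : (x : V) ∈ A
  · rw [Equiv.trans_apply, Equiv.sumCompl_symm_apply_of_pos (p := fun x : S => (x : V) ∈ A) hx]
    exact iff_of_true (e₁ ⟨x, hx⟩).2 hx
  · rw [Equiv.trans_apply, Equiv.sumCompl_symm_apply_of_neg (p := fun x : S => (x : V) ∈ A) hx]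
    exact iff_of_false (e₂ ⟨x, hx⟩).2 hx

/-- A graph is a copy of `B^k_n` as soon as its adjacency between the parts is described by `k`-sets
`A` and `B` in the way that `graphB` prescribes. -/
theorem nonempty_iso_graphB {V : Type*} [Fintype V] [DecidableEq V] {G : SimpleGraph V}
    {X Y A B : Finset V} {k n : ℕ} (hV : Fintype.card V = 2 * n) (hX : X.card = n)
    (hY : Y.card = n) (hb : G.IsBipartiteWith (X : Set V) Y) (hAX : A ⊆ X) (hBY : B ⊆ Y)
    (hA : A.card = k) (hB : B.card = k)
    (hadj : ∀ x ∈ X, ∀ y ∈ Y, G.Adj x y ↔ (x ∈ A → y ∈ B)) :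
    Nonempty (G ≃g graphB k n) := by
  obtain ⟨e, he⟩ := exists_equiv_fin_lt_iff hAX hX hA
  obtain ⟨f, hf⟩ := exists_equiv_fin_lt_iff hBY hY hB
  have hd : Disjoint X Y := by simpa using hb.disjoint
  let φ : Fin n ⊕ Fin n → V := Sum.elim (fun i => (e.symm i : V)) fun j => (f.symm j : V)
  have hinj : Function.Injective φ :=
    Function.Injective.sumElim (Subtype.val_injective.comp e.symm.injective)
      (Subtype.val_injective.comp f.symm.injective) fun i j hij =>
        disjoint_left.1 hd (e.symm i).2 (hij ▸ (f.symm j).2)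
  have hbij : Function.Bijective φ :=
    (Fintype.bijective_iff_injective_and_card φ).2 ⟨hinj, by simp [hV]; omega⟩
  have hlr : ∀ i j, G.Adj (φ (Sum.inl i)) (φ (Sum.inr j)) ↔
      (graphB k n).Adj (Sum.inl i) (Sum.inr j) := by
    intro i j
    rw [graphB_adj_inl_inr]
    have h1 := he (e.symm i)
    have h2 := hf (f.symm j)
    rw [Equiv.apply_symm_apply] at h1 h2
    rw [h1, h2]
    exact hadj _ (e.symm i).2 _ (f.symm j).2
  refine ⟨RelIso.symm ⟨Equiv.ofBijective φ hbij, fun {a b} => ?_⟩⟩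
  simp only [Equiv.ofBijective_apply]
  rcases a with i | i <;> rcases b with j | j
  · simp only [graphB_not_adj_inl_inl, iff_false]
    intro h
    exact disjoint_left.1 hd (e.symm j).2
      (mem_coe.1 (hb.mem_of_mem_adj (mem_coe.2 (e.symm i).2) h))
  · exact hlr i j
  · rw [SimpleGraph.adj_comm, hlr, SimpleGraph.adj_comm]
  · simp only [graphB_not_adj_inr_inr, iff_false]
    intro h
    exact disjoint_right.1 hd (f.symm j).2
      (mem_coe.1 (hb.symm.mem_of_mem_adj (mem_coe.2 (f.symm i).2) h))

theorem not_isHamiltonian_of_iso_graphB {V : Type*} [Fintype V] [DecidableEq V]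
    {G : SimpleGraph V} {k n : ℕ} (hk : 1 ≤ k) (hkn : k < n) (hV : Fintype.card V = 2 * n)
    (φ : G ≃g graphB k n) : ¬ G.IsHamiltonian := by
  set I : Finset (Fin n) := univ.filter fun i => (i : ℕ) < k with hI
  have hl : Function.Injective fun i : Fin n => φ.symm (Sum.inl i) :=
    φ.symm.injective.comp Sum.inl_injective
  have hr : Function.Injective fun i : Fin n => φ.symm (Sum.inr i) :=
    φ.symm.injective.comp Sum.inr_injective
  refine not_isHamiltonian_of_neighbors_subset (by omega) hV
    (A := I.image fun i => φ.symm (Sum.inl i)) (B := I.image fun i => φ.symm (Sum.inr i))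
    (w := φ.symm (Sum.inl ⟨k, hkn⟩)) ?_ ?_ ?_ ?_
  · exact ⟨_, mem_image_of_mem _ (show (⟨0, by omega⟩ : Fin n) ∈ I by
      simp only [hI, mem_filter, mem_univ, true_and]; omega)⟩
  · rw [card_image_of_injective _ hl, card_image_of_injective _ hr]
  · intro a ha v hav
    obtain ⟨i, hi, rfl⟩ := mem_image.1 ha
    rw [← φ.map_adj_iff, RelIso.apply_symm_apply] at hav
    rcases hv : φ v with j | j
    · rw [hv] at hav
      exact absurd hav (graphB_not_adj_inl_inl i j)
    · rw [hv, graphB_adj_inl_inr] at hav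
      refine mem_image.2 ⟨j, ?_, by rw [← hv, RelIso.symm_apply_apply]⟩
      simpa [hI] using hav (by simpa [hI] using hi)
  · simp [hI]

/-! ### The spectral condition for Hamiltonicity -/

theorem theorem1p7 {V : Type*} [Fintype V] [DecidableEq V] (G : SimpleGraph V)
    [DecidableRel G.Adj] (k n : ℕ) (hk : 1 ≤ k) (hn : k ^ 3 + 2 * k + 4 ≤ n)
    (hV : Fintype.card V = 2 * n) (hG : G.IsBalancedBipartite) (hδ : k ≤ G.minDegree)
    (hlam : Real.sqrt ((n : ℝ) * ((n : ℝ) - (k : ℝ))) ≤ G.spectralRad) :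
    ¬ G.IsHamiltonian ↔ Nonempty (G ≃g graphB k n) := by
  have hkn : k < n := by linarith [Nat.zero_le (k ^ 3)]
  refine ⟨fun hH => ?_, fun ⟨φ⟩ => not_isHamiltonian_of_iso_graphB hk hkn hV φ⟩
  have hδ' : ∀ v, k ≤ G.degree v := fun v => hδ.trans (G.minDegree_le_degree v)
  obtain ⟨X, Y, hXY, hcard, hb⟩ := hG
  have hd : Disjoint X Y := by simpa using hb.disjoint
  have hsum : X.card + Y.card = 2 * n := by
    rw [← card_union_of_disjoint hd, hXY, card_univ, hV]
  have hX : X.card = n := by omega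
  have hY : Y.card = n := by omega
  have hpos : 0 < (n : ℝ) * ((n : ℝ) - k) := by
    have h1 : (k : ℝ) < n := by exact_mod_cast hkn
    have h2 : (0 : ℝ) ≤ k := Nat.cast_nonneg k
    exact mul_pos (by linarith) (by linarith)
  obtain ⟨μ, hcμ, z, hz0, hz⟩ :=
    exists_eigenvector_of_le_spectralRad (Real.sqrt_pos.2 hpos) hlam
  have hμ : 0 < μ := (Real.sqrt_pos.2 hpos).trans_le hcμ
  have hμsq : (n : ℝ) * ((n : ℝ) - k) ≤ μ ^ 2 := Real.sqrt_le_left hμ.le |>.1 hcμ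
  have he : n * n ≤ ∑ x ∈ X, G.degree x + n * k := by
    have h1 := hμsq.trans (sq_eigenvalue_le_sum_degree hb hXY hμ hz0 hz)
    have h2 : (n : ℝ) * n ≤ ((∑ x ∈ X, G.degree x : ℕ) : ℝ) + n * k := by linarith
    exact_mod_cast h2
  -- A non-Hamiltonian graph is contained in `B^k_n`; the spectral gap makes it equal to it.
  have hiso : ∀ {X Y A B : Finset V}, X ∪ Y = univ → X.card = n → Y.card = n →
      G.IsBipartiteWith (X : Set V) Y → A ⊆ X → B ⊆ Y → A.card = k → B.card = k →
      (∀ a ∈ A, ∀ v, G.Adj a v → v ∈ B) → Nonempty (G ≃g graphB k n) := by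
    intro X Y A B hXY hX hY hb hAX hBY hA hB hAB
    refine nonempty_iso_graphB hV hX hY hb hAX hBY hA hB fun x hx y hy =>
      ⟨fun h hxA => hAB x hxA y h, fun h => ?_⟩
    by_cases hxA : x ∈ A
    · have hN : G.neighborFinset x = B :=
        eq_of_subset_of_card_le (fun v hv => hAB x hxA v (by simpa using hv))
          (by rw [hB, SimpleGraph.card_neighborFinset_eq_degree]; exact hδ' x)
      rw [← SimpleGraph.mem_neighborFinset, hN]
      exact h hxA
    · by_contra hna
      exact (sq_eigenvalue_lt_of_missing_edge hk hn hX hY hb hXY hAX hBY hA hB hAB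
        (mem_sdiff.2 ⟨hx, hxA⟩) hy hna hμ hz0 hz).not_ge hμsq
  obtain ⟨A, B, ⟨hAX, hBY⟩ | ⟨hAY, hBX⟩, hA, hB, hAB⟩ :=
    exists_sparse_pair_of_not_isHamiltonian hk hn hV hX hY hb hδ' he hH
  · exact hiso hXY hX hY hb hAX hBY hA hB hAB
  · exact hiso (by rwa [union_comm]) hY hX hb.symm hAY hBX hA hB hAB
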